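/- Let $(P,\theta)$ be a labeled poset: $P$ is a (possibly infinite) poset and $\theta : P \to \mathbb P$ is an injection into the positive integers. Let $Q$ and $R$ be finite convex subsets of $P$ (a subset is convex if it contains every $r \in P$ with $s \le r \le t$ for some elements $s,t$ of it). For a finite subset $X \subseteq P$ with the induced order, a $(X,\theta)$-partition is a map $\sigma : X \to \mathbb P$ such that for each covering relation $s \lessdot t$ in $X$ one has $\sigma(s) \le \sigma(t)$ if $\theta(s) < \theta(t)$, and $\sigma(s) < \sigma(t)$ if $\theta(t) < \theta(s)$. Put $$K_{X,\theta} = \sum_{\sigma} x_1^{\#\sigma^{-1}(1)} x_2^{\#\sigma^{-1}(2)} \cdots \in \mathbb Z[[x_1,x_2,\ldots]],$$ the sum over all $(X,\theta)$-partitions $\sigma$. For $s \notin X$ write $s < X$ (resp. $s > X$) if $s < t$ (resp. $s > t$) for some $t \in X$; write $s \sim X$ if $s \in X$ or $s$ is incomparable with all elements of $X$. Define $$Q \wedge R = \{s \in R \mid s < Q\} \cup \{s \in Q \mid s \sim R \text{ or } s < R\},$$ $$Q \vee R = \{s \in Q \mid s > R\} \cup \{s \in R \mid s \sim Q \text{ or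 } s > Q\}.$$ For a composition $\alpha = (\alpha_1,\ldots,\alpha_k)$ of $n \ge 0$ let $D(\alpha) = \{\alpha_1, \alpha_1+\alpha_2, \ldots, \alpha_1+\cdots+\alpha_{k-1}\}$, let $M_\alpha = \sum_{i_1 < \cdots < i_k} x_{i_1}^{\alpha_1} \cdots x_{i_k}^{\alpha_k}$, and let the fundamental quasi-symmetric function be $L_\alpha = \sum_{\beta} M_\beta$, the sum over the compositions $\beta$ of $n$ with $D(\alpha) \subseteq D(\beta)$. A power series $f\in\mathbb Z[[x_1,x_2,\ldots]]$ is quasi-symmetric if it has bounded degree and, for all positive integers $a_1,\ldots,a_k$, the coefficients of $x_{i_1}^{a_1}\cdots x_{i_k}^{a_k}$ and $x_{j_1}^{a_1}\cdots x_{j_k}^{a_k}$ in $f$ are equal whenever $i_1<\cdots<i_k$ and $j_1<\cdots<j_k$. Then $$K_{Q\wedge R,\theta}\,K_{Q\vee R,\theta} - K_{Q,\theta}\,K_{R,\theta}$$ is quasi-symmetric and is a finite linear combination of fundamental quasi-symmetric functions $L_\alpha$ with non-negative integer coefficients. -/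

import Mathlib

namespace CellTransfer

/-! ### Quasi-symmetric functions

Formal power series in `x₁, x₂, …` over `ℤ` are elements of `MvPowerSeries ℕ+ ℤ`. -/

/-- The exponent of the monomial `x_{i₁}^{a₁} ⋯ x_{i_k}^{a_k}`. -/
noncomputable def monomialExp {k : ℕ} (i : Fin k → ℕ+) (a : Fin k → ℕ) : ℕ+ →₀ ℕ :=
  ∑ t, Finsupp.single (i t) (a t)

/-- `f` is quasi-symmetric: it has bounded degree, and the coefficients of
`x_{i₁}^{a₁} ⋯ x_{i_k}^{a_k}` and `x_{j₁}^{a₁} ⋯ x_{j_k}^{a_k}` agree whenever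
`i₁ < ⋯ < i_k` and `j₁ < ⋯ < j_k` (with all `a_t` positive). -/
def IsQuasiSymmetric (f : MvPowerSeries ℕ+ ℤ) : Prop :=
  (∃ N : ℕ, ∀ d : ℕ+ →₀ ℕ, MvPowerSeries.coeff d f ≠ 0 → d.degree ≤ N) ∧
  ∀ (k : ℕ) (a : Fin k → ℕ) (i j : Fin k → ℕ+), (∀ t, 0 < a t) →
    StrictMono i → StrictMono j →
    MvPowerSeries.coeff (monomialExp i a) f = MvPowerSeries.coeff (monomialExp j a) f

/-- The set `D(α) = {α₁, α₁ + α₂, …, α₁ + ⋯ + α_{k-1}}` of a composition `α` of `n`. -/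
def descentSet {n : ℕ} (α : Composition n) : Finset ℕ :=
  (Finset.Ioo 0 α.length).image α.sizeUpTo

/-- The monomial quasi-symmetric function
`M_α = ∑_{i₁ < ⋯ < i_k} x_{i₁}^{α₁} ⋯ x_{i_k}^{α_k}`, given by its coefficients: that of `x^d`
is the number of index sequences `i₁ < ⋯ < i_k` whose monomial is `x^d`. -/
noncomputable def monomialQSym {n : ℕ} (α : Composition n) : MvPowerSeries ℕ+ ℤ :=
  fun d => ({i : Fin α.length → ℕ+ |
    StrictMono i ∧ monomialExp i α.blocksFun = d}.ncard : ℤ)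

/-- The fundamental quasi-symmetric function `L_α`: the sum of `M_β` over the compositions `β`
of the same size that refine `α`, that is, with `D(α) ⊆ D(β)`. -/
noncomputable def fundamentalQSym {n : ℕ} (α : Composition n) : MvPowerSeries ℕ+ ℤ :=
  ∑ β ∈ (Finset.univ : Finset (Composition n)).filter (fun β => descentSet α ⊆ descentSet β),
    monomialQSym β

/-- `f` is `L`-positive: a quasi-symmetric function that is a (finite) linear combination of
fundamental quasi-symmetric functions with non-negative integer coefficients. -/
def IsLPositive (f : MvPowerSeries ℕ+ ℤ) : Prop :=
  IsQuasiSymmetric f ∧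
  ∃ c : (Σ n : ℕ, Composition n) →₀ ℕ, f = c.sum fun α m => m • fundamentalQSym α.2

/-! ### Labeled posets and `(P, θ)`-partitions -/

section
variable {P : Type*} [PartialOrder P]

/-- `σ : P → ℕ+` is a `(P, θ)`-partition. -/
def IsPPartition (θ : P → ℕ+) (σ : P → ℕ+) : Prop :=
  ∀ s t : P, s ⋖ t → (θ s < θ t → σ s ≤ σ t) ∧ (θ t < θ s → σ s < σ t)

/-- For a finite poset `P`, the generating function
`K_{P,θ} = ∑_σ x₁^{#σ⁻¹(1)} x₂^{#σ⁻¹(2)} ⋯` over all `(P, θ)`-partitions `σ`, given by its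
coefficients: that of `x^d` is the (finite) number of `σ` of weight `d`. -/
noncomputable def genFun (θ : P → ℕ+) : MvPowerSeries ℕ+ ℤ :=
  fun d => ({σ : P → ℕ+ |
    IsPPartition θ σ ∧ ∀ k : ℕ+, {p | σ p = k}.ncard = d k}.ncard : ℤ)

/-- `K_{Q,θ}` for a subset `Q` of `P`, with the induced order and the restricted labeling. -/
noncomputable def K (θ : P → ℕ+) (Q : Set P) : MvPowerSeries ℕ+ ℤ :=
  genFun (fun q : Q => θ q)

/-! ### Cell transfer -/

/-- `s < Q`. -/
def Below (s : P) (Q : Set P) : Prop := s ∉ Q ∧ ∃ t ∈ Q, s < t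

/-- `s > Q`. -/
def Above (s : P) (Q : Set P) : Prop := s ∉ Q ∧ ∃ t ∈ Q, t < s

/-- `s ∼ Q`: either `s ∈ Q`, or `s` is incomparable with all elements of `Q`. -/
def Sim (s : P) (Q : Set P) : Prop := s ∈ Q ∨ ∀ t ∈ Q, ¬ s ≤ t ∧ ¬ t ≤ s

/-- The cell transfer operation `Q ∧ R`. -/
def wedge (Q R : Set P) : Set P :=
  {s | s ∈ R ∧ Below s Q} ∪ {s | s ∈ Q ∧ (Sim s R ∨ Below s R)}

/-- The cell transfer operation `Q ∨ R`. -/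
def vee (Q R : Set P) : Set P :=
  {s | s ∈ Q ∧ Above s R} ∪ {s | s ∈ R ∧ (Sim s Q ∨ Above s Q)}

end

end CellTransfer

/-!
For `X` finite, a map `σ : X → ℕ+` is an `(X, θ)`-partition if and only if `s ↦ (σ s, θ s)` is
strictly increasing for the lexicographic order (`isPPartition_iff`). Since `Q ∧ R` and `Q ∨ R`
together contain each element of `P` as often as `Q` and `R` do, both products of generating
functions enumerate by weight certain maps on the disjoint union `Q ⊕ R` (`K_mul_K`,
`K_wedge_mul_K_vee`).

The cell transfer is a weight-preserving injection from the pairs of a `(Q, θ)`-partition and an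
`(R, θ)`-partition to the pairs of a `(Q ∧ R, θ)`-partition and a `(Q ∨ R, θ)`-partition. Each
element of `Q ∩ R` first keeps its `Q`-value on `Q ∧ R` and its `R`-value on `Q ∨ R`. Monotonicity
can only fail at a pair `s < t` where the key of `s` on `R` exceeds the key of `t` on `Q`; it is
repaired by exchanging the two values at the smallest possible set of elements of `Q ∩ R`, the
closure `Transferred` under these inversions. The inversions that make up this set are visible,
with the same defining rule, in the resulting pair, and no further ones connect to it; so the set
can be recovered (`transferred_veeMap_wedgeMap_iff`) and the transfer is injective
(`injOn_transfer`). Hence the difference in the theorem enumerates the pairs that are not obtained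
by transfer.

The construction only compares keys at distinct elements of `P`, so whether a map on `Q ⊕ R` is
counted depends only on its standardization
(`standardizationClosed_transferPairs_diff`). The maps with a given standardization are, after
sorting, the weakly increasing sequences that jump at the descents of the labels, and these are
enumerated by one `L_α` (`exists_weightSeries_eq_fundamentalQSym`). So every family of maps closed
under standardization has an `L`-positive weight enumerator (`isLPositive_weightSeries`).
-/

namespace CellTransfer

section Enumerators

open Finset

/-! ### Counting maps by weight -/

/-- The weight of `τ : E → ℕ+`: the exponent of the monomial `∏ e, x_{τ e}`. -/
noncomputable def weight {E : Type*} [Fintype E] (τ : E → ℕ+) : ℕ+ →₀ ℕ :=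
  ∑ e, Finsupp.single (τ e) 1

section Weight
variable {E F : Type*} [Fintype E] [Fintype F]

lemma weight_apply (τ : E → ℕ+) (k : ℕ+) : weight τ k = {e | τ e = k}.ncard := by
  classical
  rw [Set.ncard_eq_toFinset_card', weight, Finsupp.finsetSum_apply]
  simp [Finsupp.single_apply]

lemma weight_comp_equiv (e : F ≃ E) (τ : E → ℕ+) : weight (τ ∘ e) = weight τ :=
  Equiv.sum_comp e fun x => Finsupp.single (τ x) 1

lemma weight_sum (τ : E ⊕ F → ℕ+) :
    weight τ = weight (τ ∘ Sum.inl) + weight (τ ∘ Sum.inr) := by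
  simp [weight, Fintype.sum_sum_type]

lemma degree_weight (τ : E → ℕ+) : (weight τ).degree = Fintype.card E := by
  simp [weight, map_sum]

lemma mem_support_weight (τ : E → ℕ+) (e : E) : τ e ∈ (weight τ).support := by
  rw [Finsupp.mem_support_iff, weight_apply]
  exact ((Set.ncard_pos (Set.toFinite {x | τ x = τ e})).2 ⟨e, rfl⟩).ne'

lemma finite_weight_eq (d : ℕ+ →₀ ℕ) : {τ : E → ℕ+ | weight τ = d}.Finite := by
  refine (Set.Finite.pi' fun _ : E => d.support.finite_toSet).subset ?_
  rintro τ rfl e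
  exact mem_support_weight τ e

lemma finite_mem_weight_eq (Y : Set (E → ℕ+)) (d : ℕ+ →₀ ℕ) :
    {τ | τ ∈ Y ∧ weight τ = d}.Finite :=
  (finite_weight_eq d).subset fun _ h => h.2

/-- The weight enumerator `∑_{τ ∈ Y} ∏ e, x_{τ e}` of a set `Y` of maps `E → ℕ+`, given by its
coefficients. -/
noncomputable def weightSeries (Y : Set (E → ℕ+)) : MvPowerSeries ℕ+ ℤ :=
  fun d => ({τ | τ ∈ Y ∧ weight τ = d}.ncard : ℤ)

lemma coeff_weightSeries (Y : Set (E → ℕ+)) (d : ℕ+ →₀ ℕ) :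
    MvPowerSeries.coeff d (weightSeries Y) = ({τ | τ ∈ Y ∧ weight τ = d}.ncard : ℤ) := rfl

lemma weightSeries_comp_equiv (e : F ≃ E) (Y : Set (F → ℕ+)) :
    weightSeries {τ : E → ℕ+ | τ ∘ e ∈ Y} = weightSeries Y := by
  ext d
  rw [coeff_weightSeries, coeff_weightSeries, Nat.cast_inj]
  refine Set.ncard_congr (fun τ _ => τ ∘ e) ?_ ?_ ?_
  · rintro τ ⟨h, rfl⟩
    exact ⟨h, weight_comp_equiv e τ⟩
  · intro τ τ' _ _ h
    exact e.surjective.injective_comp_right h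
  · rintro τ ⟨h, rfl⟩
    refine ⟨τ ∘ e.symm, ⟨?_, weight_comp_equiv e.symm τ⟩, ?_⟩
    · simpa [Function.comp_assoc] using h
    · simp [Function.comp_assoc]

/-- The cardinality of a finite set partitioned into the sets `T c`. -/
lemma ncard_eq_sum_ncard {α ι : Type*} {S : Set α} (hS : S.Finite) (t : Finset ι)
    (T : ι → Set α) (hT : ∀ c ∈ t, T c ⊆ S) (h : ∀ x ∈ S, ∃! c, c ∈ t ∧ x ∈ T c) :
    S.ncard = ∑ c ∈ t, (T c).ncard := by
  have hU : S = ⋃ c ∈ (t : Set ι), T c := by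
    ext x
    simp only [Set.mem_iUnion, exists_prop]
    constructor
    · intro hx
      obtain ⟨c, hc, -⟩ := h x hx
      exact ⟨c, hc⟩
    · rintro ⟨c, hc, hx⟩
      exact hT c hc hx
  conv_lhs => rw [hU]
  rw [t.finite_toSet.ncard_biUnion (fun c hc => hS.subset (hT c hc)) ?_,
    finsum_mem_coe_finset]
  intro c hc c' hc' hne
  refine Set.disjoint_left.2 fun x hx hx' => hne ?_
  exact (h x (hT c hc hx)).unique ⟨hc, hx⟩ ⟨hc', hx'⟩

lemma weightSeries_eq_sum {ι : Type*} (Y : Set (E → ℕ+)) (t : Finset ι)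
    (T : ι → Set (E → ℕ+)) (hT : ∀ c ∈ t, T c ⊆ Y) (h : ∀ τ ∈ Y, ∃! c, c ∈ t ∧ τ ∈ T c) :
    weightSeries Y = ∑ c ∈ t, weightSeries (T c) := by
  ext d
  simp only [map_sum, coeff_weightSeries]
  rw [ncard_eq_sum_ncard (finite_mem_weight_eq Y d) t
    (fun c => {τ | τ ∈ T c ∧ weight τ = d}), Nat.cast_sum]
  · exact fun c hc τ hτ => ⟨hT c hc hτ.1, hτ.2⟩
  · rintro τ ⟨hτ, hd⟩
    simpa [hd] using h τ hτ

lemma weightSeries_mul (A : Set (E → ℕ+)) (B : Set (F → ℕ+)) :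
    weightSeries A * weightSeries B =
      weightSeries {τ : E ⊕ F → ℕ+ | τ ∘ Sum.inl ∈ A ∧ τ ∘ Sum.inr ∈ B} := by
  classical
  ext d
  rw [MvPowerSeries.coeff_mul, coeff_weightSeries]
  simp only [coeff_weightSeries]
  rw [ncard_eq_sum_ncard (finite_mem_weight_eq _ d) (antidiagonal d)
    (fun p => {τ : E ⊕ F → ℕ+ | (τ ∘ Sum.inl ∈ A ∧ weight (τ ∘ Sum.inl) = p.1) ∧
      τ ∘ Sum.inr ∈ B ∧ weight (τ ∘ Sum.inr) = p.2}), Nat.cast_sum]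
  · refine sum_congr rfl fun p _ => ?_
    rw [← Nat.cast_mul, Nat.cast_inj, ← Set.ncard_prod]
    refine Set.ncard_congr (fun q _ => Sum.elim q.1 q.2) ?_ ?_ ?_
    · rintro ⟨σ, τ⟩ ⟨h1, h2⟩
      exact ⟨h1, h2⟩
    · rintro ⟨σ, τ⟩ ⟨σ', τ'⟩ _ _ h
      simpa [Sum.elim_eq_iff] using h
    · rintro τ ⟨h1, h2⟩
      exact ⟨(τ ∘ Sum.inl, τ ∘ Sum.inr), ⟨h1, h2⟩, Sum.elim_comp_inl_inr τ⟩
  · rintro p hp τ ⟨⟨h1, h2⟩, h3, h4⟩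
    refine ⟨⟨h1, h3⟩, ?_⟩
    rw [weight_sum, h2, h4, HasAntidiagonal.mem_antidiagonal.1 hp]
  · rintro τ ⟨⟨h1, h2⟩, rfl⟩
    refine ⟨(weight (τ ∘ Sum.inl), weight (τ ∘ Sum.inr)), ⟨?_, ⟨h1, rfl⟩, h2, rfl⟩, ?_⟩
    · rw [HasAntidiagonal.mem_antidiagonal, weight_sum]
    · rintro ⟨p, q⟩ ⟨-, ⟨-, rfl⟩, -, rfl⟩
      rfl

/-- A weight-preserving injection of `A` into `B` turns the difference of the weight enumerators
into the weight enumerator of the complement of its image. -/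
lemma weightSeries_sub {A B : Set (E → ℕ+)} (φ : (E → ℕ+) → E → ℕ+)
    (hw : ∀ τ, weight (φ τ) = weight τ) (hmaps : Set.MapsTo φ A B) (hinj : Set.InjOn φ A) :
    weightSeries B - weightSeries A = weightSeries (B \ φ '' A) := by
  ext d
  rw [map_sub, coeff_weightSeries, coeff_weightSeries, coeff_weightSeries]
  have himg : {τ | τ ∈ A ∧ weight τ = d}.ncard = {τ | τ ∈ φ '' A ∧ weight τ = d}.ncard := by
    rw [← Set.InjOn.ncard_image (f := φ) (hinj.mono fun _ h => h.1)]
    congr 1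
    ext τ
    constructor
    · rintro ⟨σ, ⟨h, rfl⟩, rfl⟩
      exact ⟨⟨σ, h, rfl⟩, hw σ⟩
    · rintro ⟨⟨σ, h, rfl⟩, rfl⟩
      exact ⟨σ, ⟨h, (hw σ).symm⟩, rfl⟩
  have hsub : {τ | τ ∈ φ '' A ∧ weight τ = d} ⊆ {τ | τ ∈ B ∧ weight τ = d} := by
    rintro τ ⟨⟨σ, h, rfl⟩, hd⟩
    exact ⟨hmaps h, hd⟩
  have hdiff : {τ | τ ∈ B \ φ '' A ∧ weight τ = d} =
      {τ | τ ∈ B ∧ weight τ = d} \ {τ | τ ∈ φ '' A ∧ weight τ = d} := by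
    ext τ
    simp only [Set.mem_sdiff, Set.mem_ofPred_eq]
    tauto
  rw [himg, hdiff, Set.cast_ncard_sdiff hsub (finite_mem_weight_eq _ d)]

end Weight

/-! ### The expansion of `L_α` into weakly increasing sequences -/

open scoped Classical in
/-- The ascents of `g : Fin n → A`: the positions `m` with `g (m - 1) < g m`. -/
noncomputable def ascents {n : ℕ} {A : Type*} [LT A] (g : Fin n → A) : Finset ℕ :=
  (Ioo 0 n).filter fun m => ∃ i j : Fin n, i ⋖ j ∧ (j : ℕ) = m ∧ g i < g j

section Ascents
variable {n : ℕ}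

lemma mem_ascents {A : Type*} [LT A] {g : Fin n → A} {i j : Fin n} (h : i ⋖ j) :
    (j : ℕ) ∈ ascents g ↔ g i < g j := by
  have hij : (i : ℕ) < j := h.lt
  simp only [ascents, mem_filter, mem_Ioo]
  constructor
  · rintro ⟨-, i', j', h', hj, hg⟩
    obtain rfl := Fin.ext hj
    rwa [h.unique_left h']
  · exact fun hg => ⟨⟨by omega, j.2⟩, i, j, h, rfl, hg⟩

lemma forall_mem_Ioo_iff {p : ℕ → Prop} :
    (∀ m ∈ Ioo 0 n, p m) ↔ ∀ i j : Fin n, i ⋖ j → p j := by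
  constructor
  · intro h i j hij
    have : (i : ℕ) < j := hij.lt
    exact h _ (mem_Ioo.2 ⟨by omega, j.2⟩)
  · intro h m hm
    rw [mem_Ioo] at hm
    refine h ⟨m - 1, by omega⟩ ⟨m, hm.2⟩ ?_
    rw [Fin.covBy_iff, Nat.covBy_iff_add_one_eq]
    simp only
    omega

lemma ascents_subset_Ioo {A : Type*} [LT A] (g : Fin n → A) : ascents g ⊆ Ioo 0 n := by
  intro m hm
  simp only [ascents, mem_filter] at hm
  exact hm.1

lemma subset_ascents_iff {A : Type*} [LT A] {g : Fin n → A} {D : Finset ℕ} (hD : D ⊆ Ioo 0 n) :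
    D ⊆ ascents g ↔ ∀ i j : Fin n, i ⋖ j → (j : ℕ) ∈ D → g i < g j := by
  have h : D ⊆ ascents g ↔ ∀ m ∈ Ioo 0 n, m ∈ D → m ∈ ascents g :=
    ⟨fun h m _ hm => h hm, fun h m hm => h m (hD hm) hm⟩
  rw [h, forall_mem_Ioo_iff]
  refine forall₂_congr fun i j => forall_congr' fun hij => ?_
  rw [mem_ascents hij]

lemma ascents_eq_iff {A : Type*} [LT A] {g : Fin n → A} {D : Finset ℕ} (hD : D ⊆ Ioo 0 n) :
    ascents g = D ↔ ∀ i j : Fin n, i ⋖ j → (g i < g j ↔ (j : ℕ) ∈ D) := by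
  have h : ascents g = D ↔ ∀ m ∈ Ioo 0 n, (m ∈ ascents g ↔ m ∈ D) :=
    ⟨fun h m _ => by rw [h], fun h => ext fun m =>
      ⟨fun hm => (h m (ascents_subset_Ioo g hm)).1 hm, fun hm => (h m (hD hm)).2 hm⟩⟩
  rw [h, forall_mem_Ioo_iff]
  refine forall₂_congr fun i j => forall_congr' fun hij => ?_
  rw [mem_ascents hij]

/-- Weakly increasing sequences with the same ascents have the same level sets. -/
lemma lt_iff_lt_of_ascents_eq {A B : Type*} [LinearOrder A] [LinearOrder B] {g : Fin n → A}
    {h : Fin n → B} (hg : Monotone g) (hh : Monotone h) (heq : ascents g = ascents h)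
    (i j : Fin n) : g i < g j ↔ h i < h j := by
  rcases le_or_gt j i with hij | hij
  · exact iff_of_false (hg hij).not_gt (hh hij).not_gt
  have key : ∀ m (hm : m < n), (i : ℕ) ≤ m → (g i < g ⟨m, hm⟩ ↔ h i < h ⟨m, hm⟩) := by
    intro m hm him
    induction m, him using Nat.le_induction with
    | base => simp
    | succ m him ih =>
      have hcov : (⟨m, by omega⟩ : Fin n) ⋖ ⟨m + 1, hm⟩ := by
        rw [Fin.covBy_iff, Nat.covBy_iff_add_one_eq]
      have hstep : g ⟨m, by omega⟩ < g ⟨m + 1, hm⟩ ↔ h ⟨m, by omega⟩ < h ⟨m + 1, hm⟩ := by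
        rw [← mem_ascents hcov, heq, mem_ascents hcov]
      have him' : i ≤ ⟨m, by omega⟩ := him
      have e1 := hg him'
      have e2 := hg hcov.le
      have e3 := hh him'
      have e4 := hh hcov.le
      have ih := ih (by omega)
      constructor
      · intro hlt
        by_contra hcon
        have h1 : ¬ h i < h ⟨m, by omega⟩ := fun hc => hcon (hc.trans_le e4)
        have h2 : ¬ h ⟨m, by omega⟩ < h ⟨m + 1, hm⟩ := fun hc => hcon (e3.trans_lt hc)
        rw [← ih] at h1
        rw [← hstep] at h2
        exact h1 (hlt.trans_le (not_lt.1 h2))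
      · intro hlt
        by_contra hcon
        have h1 : ¬ g i < g ⟨m, by omega⟩ := fun hc => hcon (hc.trans_le e2)
        have h2 : ¬ g ⟨m, by omega⟩ < g ⟨m + 1, hm⟩ := fun hc => hcon (e1.trans_lt hc)
        rw [ih] at h1
        rw [hstep] at h2
        exact h1 (hlt.trans_le (not_lt.1 h2))
  exact key j j.2 hij.le

lemma mem_descentSet {α : Composition n} {m : ℕ} :
    m ∈ descentSet α ↔ ∃ t, 0 < t ∧ t < α.length ∧ α.sizeUpTo t = m := by
  simp [descentSet, and_assoc]

lemma descentSet_subset_Ioo (α : Composition n) : descentSet α ⊆ Ioo 0 n := by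
  intro m hm
  obtain ⟨t, h0, ht, rfl⟩ := mem_descentSet.1 hm
  rw [mem_Ioo]
  constructor
  · have := α.sizeUpTo_strict_mono (i := 0) (by omega)
    exact lt_of_lt_of_le (by simpa using this) (α.monotone_sizeUpTo h0)
  · exact (α.sizeUpTo_strict_mono ht).trans_le (α.sizeUpTo_le _)

lemma le_index_iff (α : Composition n) (t : ℕ) (j : Fin n) :
    t ≤ α.index j ↔ α.sizeUpTo t ≤ j := by
  constructor
  · exact fun h => (α.monotone_sizeUpTo h).trans (α.sizeUpTo_index_le j)
  · intro h
    by_contra hlt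
    have h1 := α.lt_sizeUpTo_index_succ j
    have h2 := α.monotone_sizeUpTo (not_le.1 hlt : (α.index j : ℕ) + 1 ≤ t)
    exact absurd (h1.trans_le h2) (not_lt.2 h)

lemma index_mono (α : Composition n) : Monotone α.index := by
  intro i j hij
  rw [Fin.le_def, le_index_iff α (α.index i)]
  exact (α.sizeUpTo_index_le i).trans hij

lemma ascents_index (α : Composition n) : ascents α.index = descentSet α := by
  rw [ascents_eq_iff (descentSet_subset_Ioo α)]
  intro i j hij
  rw [Fin.covBy_iff, Nat.covBy_iff_add_one_eq] at hij
  rw [mem_descentSet, Fin.lt_def]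
  constructor
  · intro h
    refine ⟨α.index j, by omega, (α.index j).2, ?_⟩
    have h1 := α.sizeUpTo_index_le j
    have h2 := (le_index_iff α (α.index j) i).not.1 (not_le.2 h)
    omega
  · rintro ⟨t, -, -, h⟩
    have h1 := (le_index_iff α t i).not.2 (by omega)
    have h2 := (le_index_iff α t j).2 h.le
    omega

lemma weight_comp_index (α : Composition n) (i : Fin α.length → ℕ+) :
    weight (i ∘ α.index) = monomialExp i α.blocksFun := by
  rw [weight, ← α.blocksFinEquiv.sum_comp, Fintype.sum_sigma, monomialExp]
  refine sum_congr rfl fun t _ => ?_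
  have : ∀ y : Fin (α.blocksFun t), α.index (α.blocksFinEquiv ⟨t, y⟩) = t :=
    α.index_embedding t
  simp [this]

/-- `M_β` enumerates the weakly increasing sequences whose ascents are exactly `D(β)`: those are
the sequences that are constant on each block of `β` and jump between consecutive blocks. -/
lemma monomialQSym_eq (β : Composition n) :
    monomialQSym β = weightSeries {g : Fin n → ℕ+ | Monotone g ∧ ascents g = descentSet β} := by
  ext d
  rw [coeff_weightSeries]
  change ((_ : ℕ) : ℤ) = _
  rw [Nat.cast_inj]
  refine Set.ncard_congr (fun i _ => i ∘ β.index) ?_ ?_ ?_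
  · rintro i ⟨hi, rfl⟩
    refine ⟨⟨hi.monotone.comp (index_mono β), ?_⟩, weight_comp_index β i⟩
    rw [← ascents_index β, ascents_eq_iff (ascents_subset_Ioo _)]
    intro a b hab
    rw [mem_ascents hab]
    exact hi.lt_iff_lt
  · intro i i' _ _ h
    refine Function.Surjective.injective_comp_right (fun t => ?_) h
    exact ⟨_, β.index_embedding t ⟨0, β.one_le_blocksFun t⟩⟩
  · rintro g ⟨⟨hg, hasc⟩, rfl⟩
    have hlt := lt_iff_lt_of_ascents_eq hg (index_mono β) (hasc.trans (ascents_index β).symm)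
    let r : Fin β.length → Fin n := fun t => β.embedding t ⟨0, β.one_le_blocksFun t⟩
    have hr : ∀ t, β.index (r t) = t := fun t => β.index_embedding t _
    have hcomp : (g ∘ r) ∘ β.index = g := by
      funext j
      refine le_antisymm (not_lt.1 fun h => ?_) (not_lt.1 fun h => ?_)
      · simp [hlt, hr] at h
      · simp [hlt, hr] at h
    refine ⟨g ∘ r, ⟨fun s t hst => ?_, ?_⟩, hcomp⟩
    · simpa [hlt, hr] using hst
    · rw [← weight_comp_index, hcomp]

lemma mem_boundaries_iff (α : Composition n) (m : Fin (n + 1)) :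
    m ∈ α.boundaries ↔ (m : ℕ) = 0 ∨ (m : ℕ) = n ∨ (m : ℕ) ∈ descentSet α := by
  rw [Composition.boundaries, mem_map, mem_descentSet]
  constructor
  · rintro ⟨t, -, rfl⟩
    by_cases h0 : (t : ℕ) = 0
    · left
      simp [Composition.boundary, h0]
    by_cases h1 : (t : ℕ) = α.length
    · right; left
      simp [Composition.boundary, h1]
    · exact .inr (.inr ⟨t, by omega, by omega, rfl⟩)
  · rintro (h | h | ⟨t, -, ht, h⟩)
    · exact ⟨0, mem_univ _, Fin.ext (by simp [h])⟩
    · exact ⟨Fin.last _, mem_univ _, Fin.ext (by simp [h])⟩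
    · exact ⟨⟨t, by omega⟩, mem_univ _, Fin.ext (by simpa [Composition.boundary] using h)⟩

lemma descentSet_injective : Function.Injective (descentSet (n := n)) := by
  intro α β h
  apply (compositionEquiv n).injective
  apply CompositionAsSet.ext
  change α.boundaries = β.boundaries
  ext m
  rw [mem_boundaries_iff, mem_boundaries_iff, h]

lemma exists_descentSet_eq {D : Finset ℕ} (hD : D ⊆ Ioo 0 n) :
    ∃ α : Composition n, descentSet α = D := by
  classical
  let c : CompositionAsSet n :=
    { boundaries := univ.filter fun m : Fin (n + 1) => (m : ℕ) = 0 ∨ (m : ℕ) = n ∨ (m : ℕ) ∈ D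
      zero_mem := by simp
      getLast_mem := by simp }
  refine ⟨c.toComposition, ?_⟩
  ext m
  have key : ∀ (m : ℕ) (hm : m ∈ Ioo 0 n), m ∈ descentSet c.toComposition ↔ m ∈ D := by
    intro m hm
    rw [mem_Ioo] at hm
    have h1 := mem_boundaries_iff c.toComposition ⟨m, by omega⟩
    rw [c.toComposition_boundaries] at h1
    simp only [c, mem_filter, mem_univ, true_and, hm.1.ne', hm.2.ne, false_or] at h1
    exact h1.symm
  exact ⟨fun h => (key m (descentSet_subset_Ioo _ h)).1 h, fun h => (key m (hD h)).2 h⟩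

/-- `L_α` enumerates the weakly increasing sequences with an ascent at each element of `D(α)`; they
are sorted into `M_β`'s by their set of ascents. -/
lemma fundamentalQSym_eq (α : Composition n) :
    fundamentalQSym α =
      weightSeries {g : Fin n → ℕ+ | Monotone g ∧ descentSet α ⊆ ascents g} := by
  rw [fundamentalQSym, weightSeries_eq_sum _
    (univ.filter fun β : Composition n => descentSet α ⊆ descentSet β)
    (fun β => {g : Fin n → ℕ+ | Monotone g ∧ ascents g = descentSet β})]
  · exact sum_congr rfl fun β _ => monomialQSym_eq β
  · rintro β hβ g ⟨hg, h⟩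
    exact ⟨hg, h ▸ (mem_filter.1 hβ).2⟩
  · rintro g ⟨hg, h⟩
    obtain ⟨β, hβ⟩ := exists_descentSet_eq (ascents_subset_Ioo g)
    refine ⟨β, ⟨by simp [hβ, h], hg, hβ.symm⟩, ?_⟩
    rintro γ ⟨-, -, hγ⟩
    exact descentSet_injective (hγ.symm.trans hβ.symm)

end Ascents

/-! ### `L`-positivity of sets closed under standardization -/

/-- The value of `τ` at `x` with ties broken by the label of `x`. Two maps `τ` with the same
comparisons between these keys have the same standardization. -/
def key {E Λ : Type*} (ℓ : E → Λ) (τ : E → ℕ+) (x : E) : ℕ+ ×ₗ Λ :=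
  toLex (τ x, ℓ x)

section Key
variable {E Λ : Type*} {ℓ : E → Λ}

lemma key_injective (hℓ : Function.Injective ℓ) (τ : E → ℕ+) : Function.Injective (key ℓ τ) :=
  fun _ _ h => hℓ (Prod.ext_iff.1 (toLex.injective h)).2

variable [LinearOrder Λ]

lemma key_lt_key {τ : E → ℕ+} {x y : E} :
    key ℓ τ x < key ℓ τ y ↔ τ x < τ y ∨ τ x = τ y ∧ ℓ x < ℓ y :=
  Prod.Lex.toLex_lt_toLex

lemma key_lt_key_of_label_ne {τ : E → ℕ+} {x y : E} (h : ℓ x ≠ ℓ y) :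
    key ℓ τ x < key ℓ τ y ↔ τ x ≤ τ y ∧ (ℓ y < ℓ x → τ x < τ y) := by
  rw [key_lt_key]
  rcases lt_trichotomy (τ x) (τ y) with h1 | h1 | h1
  · simp [h1, h1.le]
  · simp [h1, h.le_iff_lt]
  · simp [h1.not_gt, h1.ne', h1.not_ge]

variable [Fintype E]

/-- Each `τ` has a unique standardization: the enumeration `π` of `E` that sorts the keys. -/
lemma existsUnique_strictMono_key (hℓ : Function.Injective ℓ) (τ : E → ℕ+) :
    ∃! π : Fin (Fintype.card E) ≃ E, StrictMono (key ℓ τ ∘ π) := by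
  let e := (Fintype.equivFin E).symm
  let s := Tuple.sort (key ℓ τ ∘ e)
  refine ⟨s.trans e, ?_, ?_⟩
  · exact (Tuple.monotone_sort (key ℓ τ ∘ e)).strictMono_of_injective
      (((key_injective hℓ τ).comp e.injective).comp s.injective)
  · intro π hπ
    have hmono : StrictMono (key ℓ τ ∘ s.trans e) :=
      (Tuple.monotone_sort (key ℓ τ ∘ e)).strictMono_of_injective
        (((key_injective hℓ τ).comp e.injective).comp s.injective)
    have h : key ℓ τ ∘ π = key ℓ τ ∘ s.trans e := by
      rw [← hπ.range_inj hmono, Set.range_comp, Set.range_comp, π.surjective.range_eq,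
        (s.trans e).surjective.range_eq]
    exact Equiv.ext fun i => key_injective hℓ τ (congrFun h i)

/-- The maps with a given standardization are enumerated by a single `L_α`, where `D(α)` records
the descents of the labels along the standardization. -/
lemma exists_weightSeries_eq_fundamentalQSym (hℓ : Function.Injective ℓ) {n : ℕ} (π : Fin n ≃ E) :
    ∃ α : Composition n,
      weightSeries {τ : E → ℕ+ | StrictMono (key ℓ τ ∘ π)} = fundamentalQSym α := by
  obtain ⟨α, hα⟩ := exists_descentSet_eq
    (ascents_subset_Ioo fun i : Fin n => OrderDual.toDual (ℓ (π i)))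
  refine ⟨α, ?_⟩
  rw [fundamentalQSym_eq, ← weightSeries_comp_equiv π]
  congr 1
  ext τ
  simp only [Set.mem_ofPred_eq]
  rw [subset_ascents_iff (descentSet_subset_Ioo α), strictMono_iff_forall_covBy,
    monotone_iff_forall_covBy]
  simp only [← forall_and]
  refine forall₂_congr fun i j => forall_congr' fun hij => ?_
  rw [hα, mem_ascents hij]
  exact key_lt_key_of_label_ne (hℓ.ne (π.injective.ne hij.lt.ne))

/-- Membership in `Y` only depends on the standardization: it is inherited by every map with the same
comparisons of keys. -/
def StandardizationClosed (ℓ : E → Λ) (Y : Set (E → ℕ+)) : Prop :=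
  ∀ τ ∈ Y, ∀ τ', (∀ x y, key ℓ τ x < key ℓ τ y ↔ key ℓ τ' x < key ℓ τ' y) → τ' ∈ Y

lemma monomialExp_apply {k : ℕ} {i : Fin k → ℕ+} (hi : Function.Injective i) (a : Fin k → ℕ)
    (t : Fin k) : monomialExp i a (i t) = a t := by
  simp [monomialExp, Finsupp.single_apply, hi.eq_iff]

lemma monomialExp_apply_of_notMem_range {k : ℕ} {i : Fin k → ℕ+} (a : Fin k → ℕ) {m : ℕ+}
    (hm : m ∉ Set.range i) : monomialExp i a m = 0 := by
  rw [monomialExp, Finsupp.finsetSum_apply]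
  exact sum_eq_zero fun t _ => Finsupp.single_eq_of_ne fun h => hm ⟨t, h.symm⟩

lemma weight_comp_eq_monomialExp_iff {k : ℕ} {i : Fin k → ℕ+} (hi : Function.Injective i)
    (a : Fin k → ℕ) (u : E → Fin k) :
    weight (i ∘ u) = monomialExp i a ↔ ∀ t, {e | u e = t}.ncard = a t := by
  have h (t : Fin k) : weight (i ∘ u) (i t) = {e | u e = t}.ncard := by
    rw [weight_apply]
    simp only [Function.comp_apply, hi.eq_iff]
  constructor
  · intro heq t
    rw [← h, heq, monomialExp_apply hi]
  · intro heq
    ext m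
    by_cases hm : m ∈ Set.range i
    · obtain ⟨t, rfl⟩ := hm
      rw [h, heq, monomialExp_apply hi]
    · rw [monomialExp_apply_of_notMem_range a hm, weight_apply]
      convert Set.ncard_empty E
      ext e
      simp only [Function.comp_apply, Set.mem_ofPred_eq, Set.mem_empty_iff_false, iff_false]
      exact fun h => hm ⟨_, h⟩

lemma coeff_weightSeries_monomialExp {k : ℕ} {i : Fin k → ℕ+} (hi : Function.Injective i)
    (a : Fin k → ℕ) (Y : Set (E → ℕ+)) :
    MvPowerSeries.coeff (monomialExp i a) (weightSeries Y) =
      ({u : E → Fin k | i ∘ u ∈ Y ∧ ∀ t, {e | u e = t}.ncard = a t}.ncard : ℤ) := by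
  rw [coeff_weightSeries, Nat.cast_inj]
  symm
  refine Set.ncard_congr (fun u _ => i ∘ u) ?_ ?_ ?_
  · rintro u ⟨hu, ha⟩
    exact ⟨hu, (weight_comp_eq_monomialExp_iff hi a u).2 ha⟩
  · exact fun u v _ _ h => hi.comp_left h
  · rintro τ ⟨hτ, hw⟩
    have hrange (e : E) : τ e ∈ Set.range i := by
      by_contra hcon
      have := mem_support_weight τ e
      rw [hw, Finsupp.mem_support_iff] at this
      exact this (monomialExp_apply_of_notMem_range a hcon)
    choose u hu using hrange
    obtain rfl : i ∘ u = τ := funext hu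
    exact ⟨u, ⟨hτ, (weight_comp_eq_monomialExp_iff hi a u).1 hw⟩, rfl⟩

/-- Replacing the values `i₁ < ⋯ < i_k` of a map by `j₁ < ⋯ < j_k` preserves its standardization. -/
lemma isQuasiSymmetric_weightSeries {Y : Set (E → ℕ+)} (hY : StandardizationClosed ℓ Y) :
    IsQuasiSymmetric (weightSeries Y) := by
  refine ⟨⟨Fintype.card E, fun d hd => ?_⟩, fun k a i j _ hi hj => ?_⟩
  · rw [coeff_weightSeries, Nat.cast_ne_zero] at hd
    obtain ⟨τ, -, rfl⟩ := Set.nonempty_of_ncard_ne_zero hd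
    exact (degree_weight τ).le
  · rw [coeff_weightSeries_monomialExp hi.injective, coeff_weightSeries_monomialExp hj.injective]
    have h (u : E → Fin k) : i ∘ u ∈ Y ↔ j ∘ u ∈ Y := by
      constructor
      · exact fun hu => hY _ hu _ fun x y => by
          simp [key_lt_key, hi.lt_iff_lt, hj.lt_iff_lt, hi.injective.eq_iff, hj.injective.eq_iff]
      · exact fun hu => hY _ hu _ fun x y => by
          simp [key_lt_key, hi.lt_iff_lt, hj.lt_iff_lt, hi.injective.eq_iff, hj.injective.eq_iff]
    simp only [h]

/-- Sorting `Y` by standardization expands its weight enumerator into a sum of `L_α`'s. -/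
theorem isLPositive_weightSeries (hℓ : Function.Injective ℓ) {Y : Set (E → ℕ+)}
    (hY : StandardizationClosed ℓ Y) : IsLPositive (weightSeries Y) := by
  classical
  refine ⟨isQuasiSymmetric_weightSeries hY, ?_⟩
  -- `C π` is the class of maps with standardization `π`; `Y` is a union of such classes.
  let C (π : Fin (Fintype.card E) ≃ E) : Set (E → ℕ+) := {τ | StrictMono (key ℓ τ ∘ π)}
  have hC (π) (τ) (hτ : τ ∈ C π) (x y) :
      key ℓ τ x < key ℓ τ y ↔ π.symm x < π.symm y := by
    simpa using hτ.lt_iff_lt (a := π.symm x) (b := π.symm y)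
  have hsum : weightSeries Y = ∑ π ∈ univ.filter (fun π => (C π ∩ Y).Nonempty),
      weightSeries (C π) := by
    refine weightSeries_eq_sum Y _ C ?_ fun τ hτ => ?_
    · intro π hπ τ hτ
      obtain ⟨τ', hτ', hY'⟩ := (mem_filter.1 hπ).2
      exact hY τ' hY' τ fun x y => by rw [hC π τ hτ, hC π τ' hτ']
    · obtain ⟨π, hπ, huniq⟩ := existsUnique_strictMono_key hℓ τ
      exact ⟨π, ⟨mem_filter.2 ⟨mem_univ _, τ, hπ, hτ⟩, hπ⟩, fun π' h => huniq π' h.2⟩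
  choose α hα using fun π : Fin (Fintype.card E) ≃ E =>
    exists_weightSeries_eq_fundamentalQSym hℓ π
  refine ⟨∑ π ∈ univ.filter (fun π => (C π ∩ Y).Nonempty), Finsupp.single ⟨_, α π⟩ 1, ?_⟩
  rw [hsum, ← Finsupp.sum_finsetSum_index (by simp) (by simp [add_smul])]
  refine sum_congr rfl fun π _ => ?_
  rw [Finsupp.sum_single_index (by simp), one_smul]
  exact hα π

end Key

/-- A `(P, θ)`-partition is a map whose keys are strictly increasing. -/
lemma isPPartition_iff {X : Type*} [PartialOrder X] [Finite X] {θ : X → ℕ+}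
    (hθ : Function.Injective θ) (σ : X → ℕ+) : IsPPartition θ σ ↔ StrictMono (key θ σ) := by
  classical
  have := Fintype.ofFinite X
  let _ : LocallyFiniteOrder X := Fintype.toLocallyFiniteOrder
  rw [strictMono_iff_forall_covBy]
  refine forall₂_congr fun s t => forall_congr' fun hst => ?_
  have hne := hθ.ne hst.ne
  rw [key_lt_key_of_label_ne hne]
  rcases hne.lt_or_gt with h | h
  · simp [h, h.not_gt]
  · simpa [h, h.not_gt] using le_of_lt

lemma genFun_eq {X : Type*} [PartialOrder X] [Fintype X] {θ : X → ℕ+}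
    (hθ : Function.Injective θ) : genFun θ = weightSeries {σ | StrictMono (key θ σ)} := by
  ext d
  rw [coeff_weightSeries]
  change ((_ : ℕ) : ℤ) = _
  simp only [isPPartition_iff hθ, Set.mem_ofPred_eq, Finsupp.ext_iff, weight_apply]

end Enumerators

/-! ### Cell transfer on pairs of strictly increasing maps -/

section Transfer
variable {P : Type*} [PartialOrder P] {Q R : Set P}

lemma not_lt_of_mem_wedge_of_notMem_left (hQ : Q.OrdConnected) {s t : P} (ht : t ∈ wedge Q R)
    (htQ : t ∉ Q) (hs : s ∈ Q) : ¬ s < t := by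
  intro hst
  rcases ht with ⟨-, -, q, hq, htq⟩ | ⟨h, -⟩
  · exact htQ (hQ.out hs hq ⟨hst.le, htq.le⟩)
  · exact htQ h

lemma not_lt_of_mem_wedge_of_notMem_right (hR : R.OrdConnected) {s t : P} (ht : t ∈ wedge Q R)
    (htR : t ∉ R) (hs : s ∈ R) : ¬ s < t := by
  intro hst
  rcases ht with ⟨h, -⟩ | ⟨-, (h | h) | ⟨-, r, hr, htr⟩⟩
  · exact htR h
  · exact htR h
  · exact (h s hs).2 hst.le
  · exact htR (hR.out hs hr ⟨hst.le, htr.le⟩)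

lemma not_lt_of_mem_vee_of_notMem_right (hR : R.OrdConnected) {s t : P} (hs : s ∈ vee Q R)
    (hsR : s ∉ R) (ht : t ∈ R) : ¬ s < t := by
  intro hst
  rcases hs with ⟨-, -, r, hr, hrs⟩ | ⟨h, -⟩
  · exact hsR (hR.out hr ht ⟨hrs.le, hst.le⟩)
  · exact hsR h

lemma not_lt_of_mem_vee_of_notMem_left (hQ : Q.OrdConnected) {s t : P} (hs : s ∈ vee Q R)
    (hsQ : s ∉ Q) (ht : t ∈ Q) : ¬ s < t := by
  intro hst
  rcases hs with ⟨h, -⟩ | ⟨-, (h | h) | ⟨-, q, hq, hqs⟩⟩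
  · exact hsQ h
  · exact hsQ h
  · exact (h t ht).1 hst.le
  · exact hsQ (hQ.out hq ht ⟨hqs.le, hst.le⟩)

lemma mem_wedge_of_mem {s : P} (hQ : s ∈ Q) (hR : s ∈ R) : s ∈ wedge Q R :=
  .inr ⟨hQ, .inl (.inl hR)⟩

lemma mem_vee_of_mem {s : P} (hQ : s ∈ Q) (hR : s ∈ R) : s ∈ vee Q R :=
  .inr ⟨hR, .inl (.inl hQ)⟩

lemma mem_union_of_mem_wedge {s : P} (h : s ∈ wedge Q R) : s ∈ Q ∪ R := by
  rcases h with h | h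
  exacts [.inr h.1, .inl h.1]

lemma mem_union_of_mem_vee {s : P} (h : s ∈ vee Q R) : s ∈ Q ∪ R := by
  rcases h with h | h
  exacts [.inl h.1, .inr h.1]

lemma mem_vee_of_notMem_wedge {s : P} (h : s ∈ Q ∪ R) (hw : s ∉ wedge Q R) : s ∈ vee Q R := by
  by_cases hsQ : s ∈ Q
  · have hsR : s ∉ R := fun hsR => hw (mem_wedge_of_mem hsQ hsR)
    refine .inl ⟨hsQ, hsR, ?_⟩
    by_contra! hcon
    refine hw (.inr ⟨hsQ, ?_⟩)
    by_cases hb : ∃ t ∈ R, s < t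
    · exact .inr ⟨hsR, hb⟩
    · push Not at hb
      refine .inl (.inr fun t ht => ⟨fun hle => ?_, fun hle => ?_⟩)
      · exact hb t ht (hle.lt_of_ne fun heq => hsR (heq ▸ ht))
      · exact hcon t ht (hle.lt_of_ne fun heq => hsR (heq ▸ ht))
  · have hsR : s ∈ R := h.resolve_left hsQ
    refine .inr ⟨hsR, ?_⟩
    by_cases ha : ∃ t ∈ Q, t < s
    · exact .inr ⟨hsQ, ha⟩
    · push Not at ha
      refine .inl (.inr fun t ht => ⟨fun hle => ?_, fun hle => ?_⟩)
      · exact hw (.inl ⟨hsR, hsQ, t, ht, hle.lt_of_ne fun heq => hsQ (heq ▸ ht)⟩)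
      · exact ha t ht (hle.lt_of_ne fun heq => hsQ (heq ▸ ht))

lemma notMem_vee_of_mem_wedge_of_notMem_left (hQ : Q.OrdConnected) {s : P}
    (hw : s ∈ wedge Q R) (hsQ : s ∉ Q) : s ∉ vee Q R := by
  intro hv
  rcases hw with ⟨-, -, q, hq, hsq⟩ | ⟨h, -⟩
  · exact not_lt_of_mem_vee_of_notMem_left hQ hv hsQ hq hsq
  · exact hsQ h

lemma notMem_wedge_of_mem_vee_of_notMem_right (hR : R.OrdConnected) {s : P}
    (hv : s ∈ vee Q R) (hsR : s ∉ R) : s ∉ wedge Q R := by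
  intro hw
  rcases hv with ⟨-, -, r, hr, hrs⟩ | ⟨h, -⟩
  · exact not_lt_of_mem_wedge_of_notMem_right hR hw hsR hr hrs
  · exact hsR h

variable {L : Type*} [LinearOrder L]

/-- The elements of `Q ∩ R` at which `lo` (a map on `Q`) and `hi` (a map on `R`) exchange their
values in order to become strictly increasing on `Q ∧ R` and `Q ∨ R`. By default the elements of
`Q ∩ R` take their `lo`-value on `Q ∧ R` and their `hi`-value on `Q ∨ R`. An inversion is a pair
`s < t` with `s ∈ R`, `t ∈ Q` and `lo t < hi s`. If `s ∈ R \ Q`, then `s` is in `Q ∧ R` with value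
`hi s`, so `t` must take the value `hi t` there (`of_left`); if `t ∈ Q \ R`, then `t` is in `Q ∨ R`
with value `lo t`, so `s` must take the value `lo s` there (`of_right`); and if both are in `Q ∩ R`,
then exchanging one of them forces exchanging the other (`up`, `down`). -/
inductive Transferred (Q R : Set P) (lo hi : P → L) : P → Prop
  | of_left {s t : P} : s ∈ R → s ∉ Q → t ∈ Q → t ∈ R → s < t → lo t < hi s →
      Transferred Q R lo hi t
  | of_right {s t : P} : s ∈ Q → s ∈ R → t ∈ Q → t ∉ R → s < t → lo t < hi s →
      Transferred Q R lo hi s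
  | up {s t : P} : Transferred Q R lo hi s → t ∈ Q → t ∈ R → s < t → lo t < hi s →
      Transferred Q R lo hi t
  | down {s t : P} : Transferred Q R lo hi t → s ∈ Q → s ∈ R → s < t → lo t < hi s →
      Transferred Q R lo hi s

namespace Transferred
variable {lo hi : P → L} {s : P}

lemma mem_left (h : Transferred Q R lo hi s) : s ∈ Q := by
  cases h <;> assumption

lemma mem_right (h : Transferred Q R lo hi s) : s ∈ R := by
  cases h <;> assumption

/-- Exchanging values at `s` raises the value on `Q ∧ R` and lowers the one on `Q ∨ R`; so no new
conflict arises with elements that are below `s` in `Q ∧ R` or above `s` in `Q ∨ R`. -/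
lemma lt (hlo : StrictMonoOn lo Q) (hhi : StrictMonoOn hi R) (h : Transferred Q R lo hi s) :
    lo s < hi s := by
  cases h with
  | of_left hs _ _ ht hst hlt => exact hlt.trans (hhi hs ht hst)
  | of_right hs _ ht _ hst hlt => exact (hlo hs ht hst).trans hlt
  | up hs _ ht hst hlt => exact hlt.trans (hhi hs.mem_right ht hst)
  | down ht hs _ hst hlt => exact (hlo hs ht.mem_left hst).trans hlt

lemma imp {lo' hi' : P → L}
    (himp : ∀ s ∈ R, ∀ t ∈ Q, s < t → lo t < hi s → lo' t < hi' s)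
    (h : Transferred Q R lo hi s) : Transferred Q R lo' hi' s := by
  induction h with
  | of_left hs hs' ht ht' hst hlt => exact .of_left hs hs' ht ht' hst (himp _ hs _ ht hst hlt)
  | of_right hs hs' ht ht' hst hlt => exact .of_right hs hs' ht ht' hst (himp _ hs' _ ht hst hlt)
  | up hs ht ht' hst hlt ih => exact .up ih ht ht' hst (himp _ hs.mem_right _ ht hst hlt)
  | down ht hs hs' hst hlt ih => exact .down ih hs hs' hst (himp _ hs' _ ht.mem_left hst hlt)

end Transferred

open scoped Classical in
/-- The map on `Q ∧ R` obtained from `lo` and `hi` by cell transfer; its values outside `Q ∧ R` are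
immaterial. -/
noncomputable def wedgeMap (Q R : Set P) (lo hi : P → L) (s : P) : L :=
  if s ∈ Q then if Transferred Q R lo hi s then hi s else lo s else hi s

open scoped Classical in
/-- The map on `Q ∨ R` obtained from `lo` and `hi` by cell transfer; its values outside `Q ∨ R` are
immaterial. -/
noncomputable def veeMap (Q R : Set P) (lo hi : P → L) (s : P) : L :=
  if s ∈ R then if Transferred Q R lo hi s then lo s else hi s else lo s

section Maps
variable {lo hi : P → L} {s : P}

lemma wedgeMap_of_notMem (h : s ∉ Q) : wedgeMap Q R lo hi s = hi s := if_neg h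

lemma veeMap_of_notMem (h : s ∉ R) : veeMap Q R lo hi s = lo s := if_neg h

lemma wedgeMap_of_transferred (h : Transferred Q R lo hi s) : wedgeMap Q R lo hi s = hi s := by
  simp [wedgeMap, h]

lemma veeMap_of_transferred (h : Transferred Q R lo hi s) : veeMap Q R lo hi s = lo s := by
  simp [veeMap, h]

lemma wedgeMap_of_not_transferred (hs : s ∈ Q) (h : ¬ Transferred Q R lo hi s) :
    wedgeMap Q R lo hi s = lo s := by
  simp [wedgeMap, h, hs]

lemma veeMap_of_not_transferred (hs : s ∈ R) (h : ¬ Transferred Q R lo hi s) :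
    veeMap Q R lo hi s = hi s := by
  simp [veeMap, h, hs]

lemma strictMonoOn_wedgeMap (hQ : Q.OrdConnected) (hR : R.OrdConnected)
    (hlo : StrictMonoOn lo Q) (hhi : StrictMonoOn hi R) (hne : ∀ s t, s ≠ t → lo s ≠ hi t) :
    StrictMonoOn (wedgeMap Q R lo hi) (wedge Q R) := by
  intro s hs t ht hst
  have hsU := mem_union_of_mem_wedge hs
  have htU := mem_union_of_mem_wedge ht
  by_cases htQ : t ∈ Q
  swap
  · have hsQ : s ∉ Q := fun h => not_lt_of_mem_wedge_of_notMem_left hQ ht htQ h hst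
    rw [wedgeMap_of_notMem htQ, wedgeMap_of_notMem hsQ]
    exact hhi (hsU.resolve_left hsQ) (htU.resolve_left htQ) hst
  by_cases htR : t ∈ R
  swap
  · have hsR : s ∉ R := fun h => not_lt_of_mem_wedge_of_notMem_right hR ht htR h hst
    have hsQ := hsU.resolve_right hsR
    rw [wedgeMap_of_not_transferred htQ fun h => htR h.mem_right,
      wedgeMap_of_not_transferred hsQ fun h => hsR h.mem_right]
    exact hlo hsQ htQ hst
  by_cases hsQ : s ∈ Q
  swap
  · have hsR := hsU.resolve_left hsQ
    rw [wedgeMap_of_notMem hsQ]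
    by_cases hT : Transferred Q R lo hi t
    · rw [wedgeMap_of_transferred hT]
      exact hhi hsR htR hst
    · rw [wedgeMap_of_not_transferred htQ hT]
      exact (not_lt.1 fun h => hT (.of_left hsR hsQ htQ htR hst h)).lt_of_ne (hne _ _ hst.ne').symm
  by_cases hTs : Transferred Q R lo hi s <;> by_cases hTt : Transferred Q R lo hi t
  · rw [wedgeMap_of_transferred hTs, wedgeMap_of_transferred hTt]
    exact hhi hTs.mem_right htR hst
  · rw [wedgeMap_of_transferred hTs, wedgeMap_of_not_transferred htQ hTt]
    exact (not_lt.1 fun h => hTt (.up hTs htQ htR hst h)).lt_of_ne (hne _ _ hst.ne').symm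
  · rw [wedgeMap_of_not_transferred hsQ hTs, wedgeMap_of_transferred hTt]
    exact (hlo hsQ htQ hst).trans (hTt.lt hlo hhi)
  · rw [wedgeMap_of_not_transferred hsQ hTs, wedgeMap_of_not_transferred htQ hTt]
    exact hlo hsQ htQ hst

lemma strictMonoOn_veeMap (hQ : Q.OrdConnected) (hR : R.OrdConnected)
    (hlo : StrictMonoOn lo Q) (hhi : StrictMonoOn hi R) (hne : ∀ s t, s ≠ t → lo s ≠ hi t) :
    StrictMonoOn (veeMap Q R lo hi) (vee Q R) := by
  intro s hs t ht hst
  have hsU := mem_union_of_mem_vee hs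
  have htU := mem_union_of_mem_vee ht
  by_cases hsR : s ∈ R
  swap
  · have htR : t ∉ R := fun h => not_lt_of_mem_vee_of_notMem_right hR hs hsR h hst
    rw [veeMap_of_notMem hsR, veeMap_of_notMem htR]
    exact hlo (hsU.resolve_right hsR) (htU.resolve_right htR) hst
  by_cases hsQ : s ∈ Q
  swap
  · have htQ : t ∉ Q := fun h => not_lt_of_mem_vee_of_notMem_left hQ hs hsQ h hst
    have htR := htU.resolve_left htQ
    rw [veeMap_of_not_transferred hsR fun h => hsQ h.mem_left,
      veeMap_of_not_transferred htR fun h => htQ h.mem_left]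
    exact hhi hsR htR hst
  by_cases htR : t ∈ R
  swap
  · have htQ := htU.resolve_right htR
    rw [veeMap_of_notMem htR]
    by_cases hT : Transferred Q R lo hi s
    · rw [veeMap_of_transferred hT]
      exact hlo hsQ htQ hst
    · rw [veeMap_of_not_transferred hsR hT]
      exact (not_lt.1 fun h => hT (.of_right hsQ hsR htQ htR hst h)).lt_of_ne (hne _ _ hst.ne').symm
  by_cases hTs : Transferred Q R lo hi s <;> by_cases hTt : Transferred Q R lo hi t
  · rw [veeMap_of_transferred hTs, veeMap_of_transferred hTt]
    exact hlo hsQ hTt.mem_left hst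
  · rw [veeMap_of_transferred hTs, veeMap_of_not_transferred htR hTt]
    exact (hTs.lt hlo hhi).trans (hhi hsR htR hst)
  · rw [veeMap_of_not_transferred hsR hTs, veeMap_of_transferred hTt]
    exact (not_lt.1 fun h => hTs (.down hTt hsQ hsR hst h)).lt_of_ne (hne _ _ hst.ne').symm
  · rw [veeMap_of_not_transferred hsR hTs, veeMap_of_not_transferred htR hTt]
    exact hhi hsR htR hst

/-- The transferred elements can be read off from the result of the cell transfer, by the same
rule with the roles of the two maps exchanged. -/
lemma transferred_veeMap_wedgeMap_iff (hlo : StrictMonoOn lo Q) (hhi : StrictMonoOn hi R) :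
    Transferred Q R (veeMap Q R lo hi) (wedgeMap Q R lo hi) s ↔ Transferred Q R lo hi s := by
  constructor
  · intro h
    induction h with
    | of_left hs hs' ht ht' hst hlt =>
      by_contra hT
      rw [veeMap_of_not_transferred ht' hT, wedgeMap_of_notMem hs'] at hlt
      exact hlt.not_gt (hhi hs ht' hst)
    | of_right hs hs' ht ht' hst hlt =>
      by_contra hT
      rw [veeMap_of_notMem ht', wedgeMap_of_not_transferred hs hT] at hlt
      exact hlt.not_gt (hlo hs ht hst)
    | up _ ht ht' hst hlt ih =>
      by_contra hT
      rw [veeMap_of_not_transferred ht' hT, wedgeMap_of_transferred ih] at hlt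
      exact hlt.not_gt (hhi ih.mem_right ht' hst)
    | down _ hs hs' hst hlt ih =>
      by_contra hT
      rw [veeMap_of_transferred ih, wedgeMap_of_not_transferred hs hT] at hlt
      exact hlt.not_gt (hlo hs ih.mem_left hst)
  · intro h
    induction h with
    | of_left hs hs' ht ht' hst hlt =>
      refine .of_left hs hs' ht ht' hst ?_
      rwa [veeMap_of_transferred (.of_left hs hs' ht ht' hst hlt), wedgeMap_of_notMem hs']
    | of_right hs hs' ht ht' hst hlt =>
      refine .of_right hs hs' ht ht' hst ?_
      rwa [veeMap_of_notMem ht', wedgeMap_of_transferred (.of_right hs hs' ht ht' hst hlt)]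
    | up h ht ht' hst hlt ih =>
      refine .up ih ht ht' hst ?_
      rwa [veeMap_of_transferred (.up h ht ht' hst hlt), wedgeMap_of_transferred h]
    | down h hs hs' hst hlt ih =>
      refine .down ih hs hs' hst ?_
      rwa [veeMap_of_transferred h, wedgeMap_of_transferred (.down h hs hs' hst hlt)]

end Maps

end Transfer

/-! ### Cell transfer on pairs of `(P, θ)`-partitions

A pair consisting of a map on `Q` and a map on `R` is a single map `τ` on the disjoint union
`Q ⊕ R`. -/

section Pairs
variable {P : Type*} {Q R : Set P} {θ : P → ℕ+}

/-- The element of `P` underlying an element of `Q ⊕ R`. -/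
def toP : Q ⊕ R → P := Sum.elim Subtype.val Subtype.val

open scoped Classical in
/-- The keys of the `Q`-component of `τ`; outside `Q` the value is immaterial, as long as the label
is the right one. -/
noncomputable def loKey (θ : P → ℕ+) (τ : Q ⊕ R → ℕ+) (s : P) : ℕ+ ×ₗ ℕ+ :=
  toLex (if h : s ∈ Q then τ (.inl ⟨s, h⟩) else 1, θ s)

open scoped Classical in
/-- The keys of the `R`-component of `τ`; outside `R` the value is immaterial, as long as the label
is the right one. -/
noncomputable def hiKey (θ : P → ℕ+) (τ : Q ⊕ R → ℕ+) (s : P) : ℕ+ ×ₗ ℕ+ :=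
  toLex (if h : s ∈ R then τ (.inr ⟨s, h⟩) else 1, θ s)

lemma loKey_coe (τ : Q ⊕ R → ℕ+) (s : Q) :
    loKey θ τ s = key (θ ∘ toP) τ (.inl s) := by
  simp [loKey, key, toP]

lemma hiKey_coe (τ : Q ⊕ R → ℕ+) (s : R) :
    hiKey θ τ s = key (θ ∘ toP) τ (.inr s) := by
  simp [hiKey, key, toP]

lemma loKey_ne_hiKey (hθ : Function.Injective θ) (τ : Q ⊕ R → ℕ+) {s t : P} (h : s ≠ t) :
    loKey θ τ s ≠ hiKey θ τ t :=
  fun heq => h (hθ (Prod.ext_iff.1 (toLex.injective heq)).2)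

open scoped Classical in
/-- The involution of `Q ⊕ R` that exchanges the two copies of each element of `S ∩ Q ∩ R`. -/
noncomputable def swapCopies (S : Set P) : Equiv.Perm (Q ⊕ R) :=
  Function.Involutive.toPerm
    (Sum.elim (fun s => if h : s.1 ∈ S ∧ s.1 ∈ R then .inr ⟨s, h.2⟩ else .inl s)
      (fun s => if h : s.1 ∈ S ∧ s.1 ∈ Q then .inl ⟨s, h.2⟩ else .inr s))
    (by
      rintro (⟨s, hs⟩ | ⟨s, hs⟩)
      · by_cases h : s ∈ S ∧ s ∈ R
        · simp [h, hs]
        · simp [h]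
      · by_cases h : s ∈ S ∧ s ∈ Q
        · simp [h, hs]
        · simp [h])

lemma swapCopies_inl_of_mem {S : Set P} {s : P} (hQ : s ∈ Q) (hR : s ∈ R) (h : s ∈ S) :
    swapCopies S (.inl ⟨s, hQ⟩ : Q ⊕ R) = .inr ⟨s, hR⟩ :=
  dif_pos (⟨h, hR⟩ : s ∈ S ∧ s ∈ R)

lemma swapCopies_inr_of_mem {S : Set P} {s : P} (hQ : s ∈ Q) (hR : s ∈ R) (h : s ∈ S) :
    swapCopies S (.inr ⟨s, hR⟩ : Q ⊕ R) = .inl ⟨s, hQ⟩ :=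
  dif_pos (⟨h, hQ⟩ : s ∈ S ∧ s ∈ Q)

lemma swapCopies_inl_of_notMem {S : Set P} {s : P} (hQ : s ∈ Q) (h : ¬ (s ∈ S ∧ s ∈ R)) :
    swapCopies S (.inl ⟨s, hQ⟩ : Q ⊕ R) = .inl ⟨s, hQ⟩ :=
  dif_neg h

lemma swapCopies_inr_of_notMem {S : Set P} {s : P} (hR : s ∈ R) (h : ¬ (s ∈ S ∧ s ∈ Q)) :
    swapCopies S (.inr ⟨s, hR⟩ : Q ⊕ R) = .inr ⟨s, hR⟩ :=
  dif_neg h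

lemma swapCopies_swapCopies (S : Set P) (x : Q ⊕ R) : swapCopies S (swapCopies S x) = x :=
  (swapCopies S : Equiv.Perm (Q ⊕ R)).left_inv x

lemma toP_swapCopies (S : Set P) (x : Q ⊕ R) : toP (swapCopies S x) = toP x := by
  rcases x with ⟨s, hs⟩ | ⟨s, hs⟩
  · by_cases h : s ∈ S ∧ s ∈ R
    · rw [swapCopies_inl_of_mem hs h.2 h.1]; rfl
    · rw [swapCopies_inl_of_notMem hs h]
  · by_cases h : s ∈ S ∧ s ∈ Q
    · rw [swapCopies_inr_of_mem h.2 hs h.1]; rfl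
    · rw [swapCopies_inr_of_notMem hs h]

lemma comp_swapCopies_swapCopies (S : Set P) (τ : Q ⊕ R → ℕ+) :
    (τ ∘ swapCopies S) ∘ swapCopies S = τ :=
  funext fun x => congrArg τ (swapCopies_swapCopies S x)

/-- `τ` and `τ'` compare in the same way at any two elements of `Q ⊕ R`, except possibly at the two
copies of one element of `P`. -/
def SameComparisons (θ : P → ℕ+) (τ τ' : Q ⊕ R → ℕ+) : Prop :=
  ∀ x y, toP x ≠ toP y →
    (key (θ ∘ toP) τ x < key (θ ∘ toP) τ y ↔ key (θ ∘ toP) τ' x < key (θ ∘ toP) τ' y)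

namespace SameComparisons
variable {τ τ' : Q ⊕ R → ℕ+}

lemma symm (h : SameComparisons θ τ τ') : SameComparisons θ τ' τ :=
  fun x y hxy => (h x y hxy).symm

lemma comp_swapCopies (h : SameComparisons θ τ τ') (S : Set P) :
    SameComparisons θ (τ ∘ swapCopies S) (τ' ∘ swapCopies S) := by
  intro x y hxy
  have := h (swapCopies S x) (swapCopies S y) (by simpa only [toP_swapCopies] using hxy)
  simpa only [key, Function.comp_apply, toP_swapCopies] using this

end SameComparisons

/-- An injective labeling of `Q ⊕ R`, in which the two copies of one element are adjacent. -/
def pairLabel (θ : P → ℕ+) (x : Q ⊕ R) : ℕ+ ×ₗ Bool :=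
  toLex (θ (toP x), x.isRight)

lemma pairLabel_injective (hθ : Function.Injective θ) :
    Function.Injective (pairLabel θ : Q ⊕ R → _) := by
  intro x y h
  obtain ⟨h1, h2⟩ := Prod.ext_iff.1 (toLex.injective h)
  have h1 := hθ h1
  rcases x with x | x <;> rcases y with y | y
  · exact congrArg Sum.inl (Subtype.ext h1)
  · simp at h2
  · simp at h2
  · exact congrArg Sum.inr (Subtype.ext h1)

lemma key_pairLabel_lt_iff (hθ : Function.Injective θ) (τ : Q ⊕ R → ℕ+) {x y : Q ⊕ R}
    (h : toP x ≠ toP y) :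
    key (pairLabel θ) τ x < key (pairLabel θ) τ y ↔
      key (θ ∘ toP) τ x < key (θ ∘ toP) τ y := by
  have hne := hθ.ne h
  simp [key_lt_key, pairLabel, Prod.Lex.toLex_lt_toLex, hne]

variable [PartialOrder P]

/-- The pairs of a `(Q, θ)`-partition and an `(R, θ)`-partition. -/
def partitionPairs (Q R : Set P) (θ : P → ℕ+) : Set (Q ⊕ R → ℕ+) :=
  {τ | StrictMonoOn (loKey θ τ) Q ∧ StrictMonoOn (hiKey θ τ) R}

open scoped Classical in
/-- The keys on `Q ∧ R` of a map `τ` on `Q ⊕ R`, where the elements of `Q ∩ R` retain their value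
on `Q`. -/
noncomputable def wedgeKey (θ : P → ℕ+) (τ : Q ⊕ R → ℕ+) (s : P) : ℕ+ ×ₗ ℕ+ :=
  if s ∈ Q then loKey θ τ s else hiKey θ τ s

open scoped Classical in
/-- The keys on `Q ∨ R` of a map `τ` on `Q ⊕ R`, where the elements of `Q ∩ R` retain their value
on `R`. -/
noncomputable def veeKey (θ : P → ℕ+) (τ : Q ⊕ R → ℕ+) (s : P) : ℕ+ ×ₗ ℕ+ :=
  if s ∈ R then hiKey θ τ s else loKey θ τ s

/-- The pairs of a `(Q ∧ R, θ)`-partition and a `(Q ∨ R, θ)`-partition, as maps on `Q ⊕ R`. -/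
def transferPairs (Q R : Set P) (θ : P → ℕ+) : Set (Q ⊕ R → ℕ+) :=
  {τ | StrictMonoOn (wedgeKey θ τ) (wedge Q R) ∧ StrictMonoOn (veeKey θ τ) (vee Q R)}

/-- The set of elements whose values are exchanged by the cell transfer. -/
def transferSet (θ : P → ℕ+) (τ : Q ⊕ R → ℕ+) : Set P :=
  {s | Transferred Q R (loKey θ τ) (hiKey θ τ) s}

/-- The cell transfer of a pair of maps. -/
noncomputable def transfer (θ : P → ℕ+) (τ : Q ⊕ R → ℕ+) : Q ⊕ R → ℕ+ :=
  τ ∘ swapCopies (transferSet θ τ)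

lemma wedgeKey_transfer (τ : Q ⊕ R → ℕ+) :
    wedgeKey θ (transfer θ τ) = wedgeMap Q R (loKey θ τ) (hiKey θ τ) := by
  funext s
  by_cases hQ : s ∈ Q
  · by_cases hT : Transferred Q R (loKey θ τ) (hiKey θ τ) s
    · have hR := hT.mem_right
      rw [wedgeMap_of_transferred hT]
      simp [wedgeKey, loKey, hiKey, hQ, hR, transfer,
        swapCopies_inl_of_mem hQ hR (S := transferSet θ τ) hT]
    · rw [wedgeMap_of_not_transferred hQ hT]
      simp [wedgeKey, loKey, hQ, transfer,
        swapCopies_inl_of_notMem hQ (S := transferSet θ τ) (fun h => hT h.1)]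
  · rw [wedgeMap_of_notMem hQ]
    by_cases hR : s ∈ R
    · simp [wedgeKey, hiKey, hQ, hR, transfer,
        swapCopies_inr_of_notMem hR (S := transferSet θ τ) (fun h => hQ h.2)]
    · simp [wedgeKey, hiKey, hQ, hR]

lemma veeKey_transfer (τ : Q ⊕ R → ℕ+) :
    veeKey θ (transfer θ τ) = veeMap Q R (loKey θ τ) (hiKey θ τ) := by
  funext s
  by_cases hR : s ∈ R
  · by_cases hT : Transferred Q R (loKey θ τ) (hiKey θ τ) s
    · have hQ := hT.mem_left
      rw [veeMap_of_transferred hT]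
      simp [veeKey, loKey, hiKey, hQ, hR, transfer,
        swapCopies_inr_of_mem hQ hR (S := transferSet θ τ) hT]
    · rw [veeMap_of_not_transferred hR hT]
      simp [veeKey, hiKey, hR, transfer,
        swapCopies_inr_of_notMem hR (S := transferSet θ τ) (fun h => hT h.1)]
  · rw [veeMap_of_notMem hR]
    by_cases hQ : s ∈ Q
    · simp [veeKey, loKey, hQ, hR, transfer,
        swapCopies_inl_of_notMem hQ (S := transferSet θ τ) (fun h => hR h.2)]
    · simp [veeKey, loKey, hQ, hR]

lemma mapsTo_transfer (hθ : Function.Injective θ) (hQ : Q.OrdConnected) (hR : R.OrdConnected) :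
    Set.MapsTo (transfer θ) (partitionPairs Q R θ) (transferPairs Q R θ) := by
  rintro τ ⟨hlo, hhi⟩
  refine ⟨?_, ?_⟩
  · rw [wedgeKey_transfer]
    exact strictMonoOn_wedgeMap hQ hR hlo hhi fun _ _ => loKey_ne_hiKey hθ τ
  · rw [veeKey_transfer]
    exact strictMonoOn_veeMap hQ hR hlo hhi fun _ _ => loKey_ne_hiKey hθ τ

/-- The exchanged elements are determined by the result, and exchanging them again undoes the
transfer. -/
lemma injOn_transfer : Set.InjOn (transfer θ) (partitionPairs Q R θ) := by
  have hrec (τ) (h : τ ∈ partitionPairs Q R θ) : transferSet θ τ =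
      {s | Transferred Q R (veeKey θ (transfer θ τ)) (wedgeKey θ (transfer θ τ)) s} := by
    ext s
    change _ ↔ Transferred Q R _ _ s
    rw [wedgeKey_transfer, veeKey_transfer, transferred_veeMap_wedgeMap_iff h.1 h.2]
    rfl
  intro τ hτ τ' hτ' heq
  have hS : transferSet θ τ = transferSet θ τ' := by
    rw [hrec τ hτ, hrec τ' hτ', heq]
  rw [← comp_swapCopies_swapCopies (transferSet θ τ) τ,
    ← comp_swapCopies_swapCopies (transferSet θ τ) τ']
  change transfer θ τ ∘ _ = _
  rw [heq, transfer, hS]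

/-! ### Dependence on the standardization only -/

/-- On `Q ∧ R` the map `wedgeKey θ τ` is a key of `τ` at a point that does not depend on `τ`. -/
lemma exists_wedgeKey_eq {s : P} (hs : s ∈ wedge Q R) :
    ∃ x : Q ⊕ R, toP x = s ∧ ∀ τ : Q ⊕ R → ℕ+, wedgeKey θ τ s = key (θ ∘ toP) τ x := by
  by_cases hQ : s ∈ Q
  · exact ⟨.inl ⟨s, hQ⟩, rfl, fun τ => (if_pos hQ).trans (loKey_coe τ ⟨s, hQ⟩)⟩
  · have hR := (mem_union_of_mem_wedge hs).resolve_left hQ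
    exact ⟨.inr ⟨s, hR⟩, rfl, fun τ => (if_neg hQ).trans (hiKey_coe τ ⟨s, hR⟩)⟩

/-- On `Q ∨ R` the map `veeKey θ τ` is a key of `τ` at a point that does not depend on `τ`. -/
lemma exists_veeKey_eq {s : P} (hs : s ∈ vee Q R) :
    ∃ x : Q ⊕ R, toP x = s ∧ ∀ τ : Q ⊕ R → ℕ+, veeKey θ τ s = key (θ ∘ toP) τ x := by
  by_cases hR : s ∈ R
  · exact ⟨.inr ⟨s, hR⟩, rfl, fun τ => (if_pos hR).trans (hiKey_coe τ ⟨s, hR⟩)⟩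
  · have hQ := (mem_union_of_mem_vee hs).resolve_right hR
    exact ⟨.inl ⟨s, hQ⟩, rfl, fun τ => (if_neg hR).trans (loKey_coe τ ⟨s, hQ⟩)⟩

namespace SameComparisons
variable {τ τ' : Q ⊕ R → ℕ+}

lemma mem_partitionPairs (h : SameComparisons θ τ τ') (hτ : τ ∈ partitionPairs Q R θ) :
    τ' ∈ partitionPairs Q R θ := by
  refine ⟨fun s hs t ht hst => ?_, fun s hs t ht hst => ?_⟩
  · have := hτ.1 hs ht hst
    lift s to Q using hs
    lift t to Q using ht
    rw [loKey_coe, loKey_coe] at this ⊢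
    exact (h (.inl s) (.inl t) hst.ne).1 this
  · have := hτ.2 hs ht hst
    lift s to R using hs
    lift t to R using ht
    rw [hiKey_coe, hiKey_coe] at this ⊢
    exact (h (.inr s) (.inr t) hst.ne).1 this

lemma transferSet_subset (h : SameComparisons θ τ τ') : transferSet θ τ ⊆ transferSet θ τ' := by
  refine fun r hr => Transferred.imp (fun s hs t ht hst hlt => ?_) hr
  lift s to R using hs
  lift t to Q using ht
  rw [loKey_coe, hiKey_coe] at hlt ⊢
  exact (h (.inl t) (.inr s) hst.ne').1 hlt

lemma transferSet_eq (h : SameComparisons θ τ τ') : transferSet θ τ = transferSet θ τ' :=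
  h.transferSet_subset.antisymm h.symm.transferSet_subset

lemma mem_transferPairs (h : SameComparisons θ τ τ') (hτ : τ ∈ transferPairs Q R θ) :
    τ' ∈ transferPairs Q R θ := by
  refine ⟨fun s hs t ht hst => ?_, fun s hs t ht hst => ?_⟩
  · have hlt := hτ.1 hs ht hst
    obtain ⟨x, rfl, hx⟩ := exists_wedgeKey_eq (θ := θ) hs
    obtain ⟨y, rfl, hy⟩ := exists_wedgeKey_eq (θ := θ) ht
    rw [hx, hy] at hlt ⊢
    exact (h x y hst.ne).1 hlt
  · have hlt := hτ.2 hs ht hst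
    obtain ⟨x, rfl, hx⟩ := exists_veeKey_eq (θ := θ) hs
    obtain ⟨y, rfl, hy⟩ := exists_veeKey_eq (θ := θ) ht
    rw [hx, hy] at hlt ⊢
    exact (h x y hst.ne).1 hlt

lemma mem_image_transfer (h : SameComparisons θ τ τ')
    (hτ : τ ∈ transfer θ '' partitionPairs Q R θ) :
    τ' ∈ transfer θ '' partitionPairs Q R θ := by
  obtain ⟨σ, hσ, rfl⟩ := hτ
  have hσ' : SameComparisons θ σ (τ' ∘ swapCopies (transferSet θ σ)) := by
    have := h.comp_swapCopies (transferSet θ σ)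
    rwa [transfer, comp_swapCopies_swapCopies] at this
  refine ⟨_, hσ'.mem_partitionPairs hσ, ?_⟩
  rw [transfer, ← hσ'.transferSet_eq, comp_swapCopies_swapCopies]

end SameComparisons

/-- Both families of pairs and the cell transfer only involve comparisons at distinct elements of
`P`, so the standardization decides which pairs are missed by the transfer. -/
lemma standardizationClosed_transferPairs_diff (hθ : Function.Injective θ) :
    StandardizationClosed (pairLabel θ)
      (transferPairs Q R θ \ transfer θ '' partitionPairs Q R θ) := by
  rintro τ ⟨h1, h2⟩ τ' h
  have hsame : SameComparisons θ τ τ' := fun x y hxy => by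
    rw [← key_pairLabel_lt_iff hθ τ hxy, ← key_pairLabel_lt_iff hθ τ' hxy, h]
  exact ⟨hsame.mem_transferPairs h1, fun h' => h2 (hsame.symm.mem_image_transfer h')⟩

/-! ### The products of generating functions -/

/-- Strict monotonicity on the subtype `X` and on the set `X` agree, when `k` extends the keys. -/
lemma strictMono_key_comp_iff {X : Set P} {E : Type*} (f : X → E) (τ : E → ℕ+)
    (k : P → ℕ+ ×ₗ ℕ+) (hk : ∀ s : X, k s = toLex (τ (f s), θ s)) :
    StrictMono (key (fun s : X => θ s) (τ ∘ f)) ↔ StrictMonoOn k X := by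
  constructor
  · intro h s hs t ht hst
    have := h (a := ⟨s, hs⟩) (b := ⟨t, ht⟩) hst
    have h1 := hk ⟨s, hs⟩
    have h2 := hk ⟨t, ht⟩
    simp only at h1 h2
    rw [h1, h2]
    exact this
  · intro h s t hst
    have := h s.2 t.2 hst
    rw [hk, hk] at this
    exact this

lemma K_eq {X : Set P} [Fintype X] (hθ : Function.Injective θ) :
    K θ X = weightSeries {σ : X → ℕ+ | StrictMono (key (fun s : X => θ s) σ)} :=
  genFun_eq (hθ.comp Subtype.val_injective)

lemma K_mul_K [Fintype Q] [Fintype R] (hθ : Function.Injective θ) :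
    K θ Q * K θ R = weightSeries (partitionPairs Q R θ) := by
  rw [K_eq hθ, K_eq hθ, weightSeries_mul]
  congr 1
  ext τ
  exact and_congr (strictMono_key_comp_iff _ τ _ (loKey_coe τ))
    (strictMono_key_comp_iff _ τ _ (hiKey_coe τ))

open scoped Classical in
/-- The inclusion of `Q ∧ R` into `Q ⊕ R`, which prefers `Q`. -/
noncomputable def wedgeEmb (s : wedge Q R) : Q ⊕ R :=
  if h : s.1 ∈ Q then .inl ⟨s, h⟩ else .inr ⟨s, (mem_union_of_mem_wedge s.2).resolve_left h⟩

open scoped Classical in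
/-- The inclusion of `Q ∨ R` into `Q ⊕ R`, which prefers `R`. -/
noncomputable def veeEmb (s : vee Q R) : Q ⊕ R :=
  if h : s.1 ∈ R then .inr ⟨s, h⟩ else .inl ⟨s, (mem_union_of_mem_vee s.2).resolve_right h⟩

lemma toP_wedgeEmb (s : wedge Q R) : toP (wedgeEmb s) = s := by
  unfold wedgeEmb
  split <;> rfl

lemma toP_veeEmb (s : vee Q R) : toP (veeEmb s) = s := by
  unfold veeEmb
  split <;> rfl

lemma wedgeEmb_ne_veeEmb (hQ : Q.OrdConnected) (hR : R.OrdConnected) (s : wedge Q R)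
    (t : vee Q R) : wedgeEmb s ≠ veeEmb t := by
  intro h
  have hst : (s : P) = t := by rw [← toP_wedgeEmb s, h, toP_veeEmb]
  obtain ⟨s, hs⟩ := s
  obtain ⟨t, ht⟩ := t
  obtain rfl : s = t := hst
  by_cases hsQ : s ∈ Q <;> by_cases hsR : s ∈ R
  · simp [wedgeEmb, veeEmb, hsQ, hsR] at h
  · exact notMem_wedge_of_mem_vee_of_notMem_right hR ht hsR hs
  · exact notMem_vee_of_mem_wedge_of_notMem_left hQ hs hsQ ht
  · exact (mem_union_of_mem_wedge hs).elim hsQ hsR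

lemma bijective_elim_wedgeEmb_veeEmb (hQ : Q.OrdConnected) (hR : R.OrdConnected) :
    Function.Bijective (Sum.elim wedgeEmb veeEmb : wedge Q R ⊕ vee Q R → Q ⊕ R) := by
  constructor
  · refine Function.Injective.sumElim (fun s t h => ?_) (fun s t h => ?_)
      (wedgeEmb_ne_veeEmb hQ hR)
    · exact Subtype.ext (by rw [← toP_wedgeEmb s, h, toP_wedgeEmb])
    · exact Subtype.ext (by rw [← toP_veeEmb s, h, toP_veeEmb])
  · rintro (⟨s, hs⟩ | ⟨s, hs⟩)
    · by_cases hw : s ∈ wedge Q R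
      · exact ⟨.inl ⟨s, hw⟩, by simp [wedgeEmb, hs]⟩
      · have hR : s ∉ R := fun hR => hw (mem_wedge_of_mem hs hR)
        exact ⟨.inr ⟨s, mem_vee_of_notMem_wedge (.inl hs) hw⟩, by simp [veeEmb, hR]⟩
    · by_cases hv : s ∈ vee Q R
      · exact ⟨.inr ⟨s, hv⟩, by simp [veeEmb, hs]⟩
      · have hQ : s ∉ Q := fun hQ => hv (mem_vee_of_mem hQ hs)
        have hw : s ∈ wedge Q R := by_contra fun hw => hv (mem_vee_of_notMem_wedge (.inr hs) hw)
        exact ⟨.inl ⟨s, hw⟩, by simp [wedgeEmb, hQ]⟩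

lemma K_wedge_mul_K_vee [Fintype Q] [Fintype R] (hθ : Function.Injective θ)
    (hQ : Q.OrdConnected) (hR : R.OrdConnected) :
    K θ (wedge Q R) * K θ (vee Q R) = weightSeries (transferPairs Q R θ) := by
  have hfin : (Q ∪ R).Finite := (Set.toFinite Q).union (Set.toFinite R)
  have := (hfin.subset fun _ => mem_union_of_mem_wedge (Q := Q) (R := R)).fintype
  have := (hfin.subset fun _ => mem_union_of_mem_vee (Q := Q) (R := R)).fintype
  rw [K_eq hθ, K_eq hθ, weightSeries_mul,
    ← weightSeries_comp_equiv (Equiv.ofBijective _ (bijective_elim_wedgeEmb_veeEmb hQ hR))]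
  congr 1
  ext τ
  refine and_congr (strictMono_key_comp_iff wedgeEmb τ _ fun s => ?_)
    (strictMono_key_comp_iff veeEmb τ _ fun s => ?_)
  · obtain ⟨s, hs⟩ := s
    by_cases h : s ∈ Q
    · simp [wedgeKey, wedgeEmb, loKey, h]
    · have := (mem_union_of_mem_wedge hs).resolve_left h
      simp [wedgeKey, wedgeEmb, hiKey, h, this]
  · obtain ⟨s, hs⟩ := s
    by_cases h : s ∈ R
    · simp [veeKey, veeEmb, hiKey, h]
    · have := (mem_union_of_mem_vee hs).resolve_right h
      simp [veeKey, veeEmb, loKey, h, this]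

end Pairs

end CellTransfer

theorem theorem4p2 {P : Type*} [PartialOrder P] (θ : P → ℕ+) (hθ : Function.Injective θ)
    (Q R : Set P) (hQfin : Q.Finite) (hRfin : R.Finite)
    (hQ : Q.OrdConnected) (hR : R.OrdConnected) :
    CellTransfer.IsLPositive
      (CellTransfer.K θ (CellTransfer.wedge Q R) * CellTransfer.K θ (CellTransfer.vee Q R)
        - CellTransfer.K θ Q * CellTransfer.K θ R) := by
  have := hQfin.fintype
  have := hRfin.fintype
  rw [CellTransfer.K_wedge_mul_K_vee hθ hQ hR, CellTransfer.K_mul_K hθ,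
    CellTransfer.weightSeries_sub (CellTransfer.transfer θ)
      (fun τ => CellTransfer.weight_comp_equiv _ τ)
      (CellTransfer.mapsTo_transfer hθ hQ hR) CellTransfer.injOn_transfer]
  exact CellTransfer.isLPositive_weightSeries (CellTransfer.pairLabel_injective hθ)
    (CellTransfer.standardizationClosed_transferPairs_diff hθ)
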